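/- Let $X$ be a simplicial group. Its Moore complex $N(X)$ is $N(X)_0=X_0$, $N(X)_k=\bigcap_{j=0}^{k-1}\ker(d_j\colon X_k\to X_{k-1})$ for $k\ge 1$, with differential $\delta_k=d_k|_{N(X)_k}$, and its homotopy groups are $\pi_i(X)=H_i(N(X))=\ker\delta_i/\delta_{i+1}(N(X)_{i+1})$ for $i\ge 0$ (with $\ker\delta_0=X_0$). For $n\ge 0$, let $\mathrm{Cot}_n$ be the reflector (left adjoint of the inclusion) of the category of simplicial groups onto the full subcategory of those whose Moore complex is trivial in degrees $>n$, and let $\mu_{n\ge}(X)$ be the kernel of the unit $X\to \mathrm{Cot}_n(X)$. Let $\mu_{\ge n+1}(X)$ be the kernel of the unit $X\to\mathrm{Cosk}_n(X)$ of the adjunction between the $n$-truncation functor $\mathrm{tr}_n$ and the $n$-coskeleton functor $\mathrm{cosk}_n$. These normal simplicial subgroups satisfy $\mu_{n+1\ge}(X)\le\mu_{\ge n+1}(X)\le\mu_{n\ge}(X)$ for all $n\ge 0$. Put $$\Pi^{n\ge}(X)=\mu_{n\ge}(X),\quad \Pi^{\ge n}(X)=\mu_{\ge n}(X),\quad \Pi_{n\ge}(X)=X/\mu_{n\ge}(X),\quad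 \Pi_{\ge n}(X)=X/\mu_{\ge n}(X),$$ $$\Pi^{n\ge}_{\ge m}(X)=\frac{\mu_{n\ge}(X)}{\mu_{\ge m}(X)},\quad \Pi^{n\ge}_{m\ge}(X)=\frac{\mu_{n\ge}(X)}{\mu_{m\ge}(X)},\quad \Pi^{\ge n}_{\ge m}(X)=\frac{\mu_{\ge n}(X)}{\mu_{\ge m}(X)},\quad \Pi^{\ge n}_{m\ge}(X)=\frac{\mu_{\ge n}(X)}{\mu_{m\ge}(X)},$$ whenever the denominator is contained in the numerator. Then the following hold, where each isomorphism is the one induced by the canonical inclusions and projections. 1. For all $n\ge 0$: $\pi_i(\Pi^{n\ge}(X))\cong\pi_i(\Pi^{\ge n+1}(X))\cong\pi_i(X)$ for $i\ge n+1$, and $\pi_i(\Pi^{n\ge}(X))=\pi_i(\Pi^{\ge n+1}(X))=0$ for $i<n+1$. 2. For all $n\ge 0$: $\pi_i(\Pi_{n\ge}(X))=\pi_i(\Pi_{\ge n+1}(X))=0$ for $i\ge n+1$, and $\pi_i(\Pi_{n\ge}(X))\cong\pi_i(\Pi_{\ge n+1}(X))\cong\pi_i(X)$ for $i<n+1$.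 3. For all $n\ge 0$: $\pi_i(\Pi^{n\ge}_{\ge n+1}(X))=0$ for all $i$. 4. For all $m>n\ge 0$: $\pi_i(\Pi^{n\ge}_{\ge m+1}(X))\cong\pi_i(X)$ for $m+1>i\ge n+1$, and $\pi_i(\Pi^{n\ge}_{\ge m+1}(X))=0$ otherwise. 5. For all $m>n\ge 0$ and all $i$: $\pi_i(\Pi^{n\ge}_{\ge m+1}(X))\cong\pi_i(\Pi^{n\ge}_{m\ge}(X))\cong\pi_i(\Pi^{\ge n+1}_{\ge m+1}(X))\cong\pi_i(\Pi^{\ge n+1}_{m\ge}(X))$. 6. In particular (for $m=n+1$), for all $n\ge 0$: $\pi_i(\Pi^{n\ge}_{\ge n+2}(X))\cong\pi_i(X)$ for $i=n+1$, and $\pi_i(\Pi^{n\ge}_{\ge n+2}(X))=0$ for $i\ne n+1$. -/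

import Mathlib

open CategoryTheory Opposite Simplicial

universe u

/-- Simplicial groups. -/
abbrev SimplicialGroup : Type (u + 1) := SimplicialObject GrpCat.{u}

namespace SimplicialGroup

/-! ### The Moore complex and the homotopy groups -/

/-- The degree `n` part of the Moore complex of `X`, as a subgroup of `X_n`: it is `X_0` for
`n = 0`, and the intersection of the kernels of `d_0, …, d_{n-1}` for `n ≥ 1`. -/
def moore (X : SimplicialGroup.{u}) (n : ℕ) : Subgroup (X _⦋n⦌) :=
  match n with
  | 0 => ⊤
  | n + 1 => ⨅ j : Fin (n + 1), (X.δ (n := n) j.castSucc).hom.ker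

/-- The cycles of degree `n` of the Moore complex: the elements of its degree `n` part which are
killed by the differential, which is the restriction of `d_n` (for `n = 0`: all of `X_0`). -/
def cycles (X : SimplicialGroup.{u}) (n : ℕ) : Subgroup (X _⦋n⦌) :=
  match n with
  | 0 => ⊤
  | n + 1 => X.moore (n + 1) ⊓ (X.δ (n := n) (Fin.last (n + 1))).hom.ker

/-- The boundaries of degree `n` of the Moore complex: the image of its degree `n + 1` part under
the differential, which is the restriction of `d_{n+1}`. -/
def boundaries (X : SimplicialGroup.{u}) (n : ℕ) : Subgroup (X _⦋n⦌) :=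
  (X.moore (n + 1)).map (X.δ (n := n) (Fin.last (n + 1))).hom

lemma mem_moore_succ {X : SimplicialGroup.{u}} {n : ℕ} {x : X _⦋n + 1⦌} :
    x ∈ X.moore (n + 1) ↔ ∀ j : Fin (n + 1), (X.δ (n := n) j.castSucc).hom x = 1 := by
  simp [moore, Subgroup.mem_iInf, MonoidHom.mem_ker]

lemma mem_cycles_succ {X : SimplicialGroup.{u}} {n : ℕ} {x : X _⦋n + 1⦌} :
    x ∈ X.cycles (n + 1) ↔ ∀ j : Fin (n + 2), (X.δ (n := n) j).hom x = 1 := by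
  rw [Fin.forall_fin_succ', cycles, Subgroup.mem_inf, mem_moore_succ, MonoidHom.mem_ker]

lemma mem_boundaries {X : SimplicialGroup.{u}} {n : ℕ} {x : X _⦋n⦌} :
    x ∈ X.boundaries n ↔ ∃ y ∈ X.moore (n + 1), (X.δ (n := n) (Fin.last (n + 1))).hom y = x :=
  Iff.rfl

/-- The differential of the Moore complex squares to zero. -/
lemma boundaries_le_cycles (X : SimplicialGroup.{u}) (n : ℕ) : X.boundaries n ≤ X.cycles n := by
  rintro x hx
  obtain ⟨y, hy, rfl⟩ := mem_boundaries.1 hx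
  cases n with
  | zero => exact Subgroup.mem_top _
  | succ n =>
    rw [mem_moore_succ] at hy
    rw [mem_cycles_succ]
    intro j
    have h := X.δ_comp_δ (n := n) (i := j) (j := Fin.last (n + 1)) (Fin.le_last j)
    have h' := ConcreteCategory.congr_hom h y
    rw [Fin.succ_last] at h'
    have e := hy j
    simp only [ConcreteCategory.comp_apply] at h'
    refine h'.trans ?_
    exact (congrArg _ e).trans (map_one _)

lemma moore_normal (X : SimplicialGroup.{u}) (n : ℕ) : (X.moore n).Normal := by
  refine ⟨fun x hx g => ?_⟩
  cases n with
  | zero => exact Subgroup.mem_top _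
  | succ n =>
    rw [mem_moore_succ] at hx ⊢
    intro j
    simp [hx j]

instance boundaries_normal (X : SimplicialGroup.{u}) (n : ℕ) : (X.boundaries n).Normal := by
  refine ⟨fun x hx g => ?_⟩
  obtain ⟨y, hy, rfl⟩ := mem_boundaries.1 hx
  refine mem_boundaries.2 ⟨_, (X.moore_normal (n + 1)).conj_mem y hy
    ((X.σ (n := n) (Fin.last n)).hom g), ?_⟩
  have h := ConcreteCategory.congr_hom (X.δ_comp_σ_succ (n := n) (i := Fin.last n)) g
  rw [Fin.succ_last] at h
  have h2 : (X.δ (n := n) (Fin.last (n + 1))).hom ((X.σ (n := n) (Fin.last n)).hom g) = g := h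
  rw [map_mul, map_mul, map_inv, h2]

/-- The homotopy group `π_n(X)`, based at the neutral element: the `n`-th homology group of the
Moore complex of `X`. -/
abbrev homotopyGroup (n : ℕ) (X : SimplicialGroup.{u}) : Type u :=
  X.cycles n ⧸ (X.boundaries n).subgroupOf (X.cycles n)

lemma map_δ {X Y : SimplicialGroup.{u}} (f : X ⟶ Y) {n : ℕ} (j : Fin (n + 2)) (x : X _⦋n + 1⦌) :
    (Y.δ j).hom ((f.app (op ⦋n + 1⦌)).hom x) = (f.app (op ⦋n⦌)).hom ((X.δ j).hom x) :=
  (ConcreteCategory.congr_hom (SimplicialObject.δ_naturality f j) x).symm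

lemma map_mem_moore {X Y : SimplicialGroup.{u}} (f : X ⟶ Y) {n : ℕ} {x : X _⦋n⦌}
    (hx : x ∈ X.moore n) : (f.app (op ⦋n⦌)).hom x ∈ Y.moore n := by
  cases n with
  | zero => exact Subgroup.mem_top _
  | succ n =>
    rw [mem_moore_succ] at hx ⊢
    intro j
    rw [map_δ, hx j, map_one]

lemma map_mem_cycles {X Y : SimplicialGroup.{u}} (f : X ⟶ Y) {n : ℕ} {x : X _⦋n⦌}
    (hx : x ∈ X.cycles n) : (f.app (op ⦋n⦌)).hom x ∈ Y.cycles n := by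
  cases n with
  | zero => exact Subgroup.mem_top _
  | succ n =>
    rw [mem_cycles_succ] at hx ⊢
    intro j
    rw [map_δ, hx j, map_one]

lemma map_mem_boundaries {X Y : SimplicialGroup.{u}} (f : X ⟶ Y) {n : ℕ} {x : X _⦋n⦌}
    (hx : x ∈ X.boundaries n) : (f.app (op ⦋n⦌)).hom x ∈ Y.boundaries n := by
  obtain ⟨y, hy, rfl⟩ := mem_boundaries.1 hx
  exact mem_boundaries.2 ⟨_, map_mem_moore f hy, map_δ f _ y⟩

/-- The map induced by a morphism on cycles. -/
def cyclesMap (n : ℕ) {X Y : SimplicialGroup.{u}} (f : X ⟶ Y) : X.cycles n →* Y.cycles n :=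
  ((f.app (op ⦋n⦌)).hom.comp (X.cycles n).subtype).codRestrict _
    fun x => map_mem_cycles f x.2

/-- The homomorphism `π_n(f) : π_n(X) → π_n(Y)` induced by a morphism `f : X → Y`. -/
def homotopyGroupMap (n : ℕ) {X Y : SimplicialGroup.{u}} (f : X ⟶ Y) :
    homotopyGroup n X →* homotopyGroup n Y :=
  QuotientGroup.map _ _ (cyclesMap n f) fun x hx => by
    rw [Subgroup.mem_comap, Subgroup.mem_subgroupOf]
    exact map_mem_boundaries f (Subgroup.mem_subgroupOf.1 hx)

/-- Two elements `x`, `x'` of `X_n` with trivial faces have the same class in `π_n(X)` if and only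
if they are homotopic in the usual simplicial sense. -/
lemma homotopyGroup_mk_eq_iff (X : SimplicialGroup.{u}) (n : ℕ) (x x' : X.cycles n) :
    (QuotientGroup.mk x : homotopyGroup n X) = QuotientGroup.mk x' ↔
      ∃ y : X _⦋n + 1⦌, (∀ j : Fin n, (X.δ (n := n) j.castSucc.castSucc).hom y = 1) ∧
        (X.δ (n := n) (Fin.last n).castSucc).hom y = x ∧
        (X.δ (n := n) (Fin.last (n + 1))).hom y = x' := by
  have hs1 : ∀ g : X _⦋n⦌, (X.δ (n := n) (Fin.last n).castSucc).hom
      ((X.σ (n := n) (Fin.last n)).hom g) = g := fun g =>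
    ConcreteCategory.congr_hom (X.δ_comp_σ_self (n := n) (i := Fin.last n)) g
  have hs2 : ∀ g : X _⦋n⦌, (X.δ (n := n) (Fin.last (n + 1))).hom
      ((X.σ (n := n) (Fin.last n)).hom g) = g := fun g => by
    have h := ConcreteCategory.congr_hom (X.δ_comp_σ_succ (n := n) (i := Fin.last n)) g
    rw [Fin.succ_last] at h
    exact h
  have hs3 : ∀ g ∈ X.cycles n, ∀ j : Fin n, (X.δ (n := n) j.castSucc.castSucc).hom
      ((X.σ (n := n) (Fin.last n)).hom g) = 1 := fun g hg j => by
    cases n with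
    | zero => exact j.elim0
    | succ n =>
      rw [mem_cycles_succ] at hg
      have h := ConcreteCategory.congr_hom (X.δ_comp_σ_of_le (n := n) (i := j.castSucc)
        (j := Fin.last n) (Fin.castSucc_le_castSucc_iff.2 (Fin.le_last j))) g
      rw [Fin.succ_last] at h
      refine h.trans ?_
      exact (congrArg (X.σ (n := n) (Fin.last n)).hom (hg _)).trans (map_one _)
  rw [QuotientGroup.eq, Subgroup.mem_subgroupOf, mem_boundaries]
  constructor
  · rintro ⟨y, hy, hxy⟩
    rw [mem_moore_succ] at hy
    refine ⟨(X.σ (n := n) (Fin.last n)).hom x * y, fun j => ?_, ?_, ?_⟩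
    · rw [map_mul, hs3 x x.2 j, hy, one_mul]
    · rw [map_mul, hs1, hy, mul_one]
    · rw [map_mul, hs2, hxy]; simp
  · rintro ⟨y, h1, h2, h3⟩
    refine ⟨((X.σ (n := n) (Fin.last n)).hom x)⁻¹ * y, ?_, ?_⟩
    · rw [mem_moore_succ]
      intro j
      induction j using Fin.lastCases with
      | last => rw [map_mul, map_inv, hs1, h2, inv_mul_cancel]
      | cast j => rw [map_mul, map_inv, hs3 x x.2 j, h1, inv_one, one_mul]
    · rw [map_mul, map_inv, hs2, h3]; simp

/-! ### Normal simplicial subgroups and quotients -/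

/-- A normal simplicial subgroup of `X` (that is, a normal subobject of `X` in the category of
simplicial groups): a family of normal subgroups `A_k ⊆ X_k` which is stable under all the
simplicial operators of `X`. -/
@[ext]
structure NormalSubobject (X : SimplicialGroup.{u}) where
  carrier : ∀ k : SimplexCategoryᵒᵖ, Subgroup (X.obj k)
  normal : ∀ k, (carrier k).Normal
  map_mem : ∀ {k l : SimplexCategoryᵒᵖ} (f : k ⟶ l) {x : X.obj k},
    x ∈ carrier k → (X.map f).hom x ∈ carrier l

namespace NormalSubobject

variable {X Y : SimplicialGroup.{u}}

instance (A : NormalSubobject X) (k : SimplexCategoryᵒᵖ) : (A.carrier k).Normal := A.normal k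

instance : PartialOrder (NormalSubobject X) :=
  PartialOrder.lift carrier fun _ _ h => NormalSubobject.ext h

lemma le_def {A B : NormalSubobject X} : A ≤ B ↔ ∀ k, A.carrier k ≤ B.carrier k := Iff.rfl

instance : Top (NormalSubobject X) :=
  ⟨{ carrier := fun _ => ⊤
     normal := fun _ => inferInstance
     map_mem := fun _ _ _ => Subgroup.mem_top _ }⟩

lemma le_top' (A : NormalSubobject X) : A ≤ ⊤ := fun _ _ _ => Subgroup.mem_top _

/-- The preimage of a normal simplicial subgroup. -/
def comap (f : X ⟶ Y) (B : NormalSubobject Y) : NormalSubobject X where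
  carrier k := (B.carrier k).comap (f.app k).hom
  normal k := (B.normal k).comap _
  map_mem {k l} g x hx := by
    rw [Subgroup.mem_comap] at hx ⊢
    have h := ConcreteCategory.congr_hom (f.naturality g) x
    rw [ConcreteCategory.comp_apply, ConcreteCategory.comp_apply] at h
    have h' : (f.app l).hom ((X.map g).hom x) = (Y.map g).hom ((f.app k).hom x) := h
    rw [h']
    exact B.map_mem g hx

/-- The kernel of a morphism of simplicial groups. -/
def ker (f : X ⟶ Y) : NormalSubobject X where
  carrier k := (f.app k).hom.ker
  normal k := inferInstance
  map_mem {k l} g x hx := by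
    rw [MonoidHom.mem_ker] at hx ⊢
    have h' : (f.app l).hom ((X.map g).hom x) = (Y.map g).hom ((f.app k).hom x) :=
      ConcreteCategory.congr_hom (f.naturality g) x
    rw [h', hx, map_one]

lemma mem_ker {f : X ⟶ Y} {k : SimplexCategoryᵒᵖ} {x : X.obj k} :
    x ∈ (ker f).carrier k ↔ (f.app k).hom x = 1 := MonoidHom.mem_ker

/-- A normal simplicial subgroup, as a simplicial group. -/
def toSimplicialGroup (A : NormalSubobject X) : SimplicialGroup.{u} where
  obj k := GrpCat.of (A.carrier k)
  map {k l} f := GrpCat.ofHom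
    (((X.map f).hom.comp (A.carrier k).subtype).codRestrict (A.carrier l)
      fun x => A.map_mem f x.2)
  map_id k := by
    refine GrpCat.hom_ext (MonoidHom.ext fun (x : A.carrier k) => ?_)
    exact Subtype.ext (a1 := ⟨(X.map (𝟙 k)).hom x.1, _⟩)
      (ConcreteCategory.congr_hom (X.map_id k) x.1)
  map_comp {k _ _} f g := by
    refine GrpCat.hom_ext (MonoidHom.ext fun (x : A.carrier k) => ?_)
    exact Subtype.ext (a1 := ⟨(X.map (f ≫ g)).hom x.1, _⟩)
      (ConcreteCategory.congr_hom (X.map_comp f g) x.1)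

/-- The inclusion of a normal simplicial subgroup. -/
def incl (A : NormalSubobject X) : A.toSimplicialGroup ⟶ X where
  app k := GrpCat.ofHom (A.carrier k).subtype
  naturality _ _ _ := rfl

/-- The inclusion of a normal simplicial subgroup in a larger one. -/
def inclusion {A B : NormalSubobject X} (h : A ≤ B) :
    A.toSimplicialGroup ⟶ B.toSimplicialGroup where
  app k := GrpCat.ofHom (Subgroup.inclusion (h k))
  naturality _ _ _ := rfl

/-- The quotient simplicial group `X / A`. -/
def quotient (A : NormalSubobject X) : SimplicialGroup.{u} where
  obj k := GrpCat.of (X.obj k ⧸ A.carrier k)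
  map {k l} f := GrpCat.ofHom (QuotientGroup.map _ _ (X.map f).hom fun _ hx => A.map_mem f hx)
  map_id k := by
    refine GrpCat.hom_ext (MonoidHom.ext fun x => ?_)
    obtain ⟨x, rfl⟩ := QuotientGroup.mk'_surjective (A.carrier k) x
    exact congrArg (QuotientGroup.mk' (A.carrier k))
      (ConcreteCategory.congr_hom (X.map_id k) x)
  map_comp {k _ m} f g := by
    refine GrpCat.hom_ext (MonoidHom.ext fun x => ?_)
    obtain ⟨x, rfl⟩ := QuotientGroup.mk'_surjective (A.carrier k) x
    exact congrArg (QuotientGroup.mk' (A.carrier m))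
      (ConcreteCategory.congr_hom (X.map_comp f g) x)

/-- The projection `X → X / A`. -/
def proj (A : NormalSubobject X) : X ⟶ A.quotient where
  app k := GrpCat.ofHom (QuotientGroup.mk' (A.carrier k))
  naturality _ _ _ := rfl

lemma proj_surjective (A : NormalSubobject X) (k : SimplexCategoryᵒᵖ) :
    Function.Surjective (A.proj.app k).hom := QuotientGroup.mk'_surjective _

lemma proj_eq_one_iff (A : NormalSubobject X) {k : SimplexCategoryᵒᵖ} {x : X.obj k} :
    (A.proj.app k).hom x = 1 ↔ x ∈ A.carrier k := QuotientGroup.eq_one_iff x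

/-- A morphism which is trivial on `A` factors through `X / A`. -/
def desc (A : NormalSubobject X) (f : X ⟶ Y) (h : A ≤ ker f) : A.quotient ⟶ Y where
  app k := GrpCat.ofHom (QuotientGroup.lift (A.carrier k) (f.app k).hom fun _ hx => h k hx)
  naturality k l g := by
    ext x
    induction x using QuotientGroup.induction_on with
    | H x => exact ConcreteCategory.congr_hom (f.naturality g) x

lemma proj_desc (A : NormalSubobject X) (f : X ⟶ Y) (h : A ≤ ker f) :
    A.proj ≫ A.desc f h = f := rfl

lemma hom_ext_of_surjective {Z : SimplicialGroup.{u}} (p : X ⟶ Y)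
    (hp : ∀ k, Function.Surjective (p.app k).hom) {f g : Y ⟶ Z} (h : p ≫ f = p ≫ g) : f = g := by
  ext k y
  obtain ⟨x, rfl⟩ := hp k y
  exact ConcreteCategory.congr_hom (congrArg (fun φ => NatTrans.app φ k) h) x

/-- For normal simplicial subgroups `B ≤ A` of `X`, the normal simplicial subgroup `B` of `A`. -/
def restrict {A B : NormalSubobject X} (_h : B ≤ A) : NormalSubobject A.toSimplicialGroup :=
  B.comap A.incl

/-- For normal simplicial subgroups `B ≤ A` of `X`, the quotient simplicial group `A / B`. -/
def subquotient {A B : NormalSubobject X} (h : B ≤ A) : SimplicialGroup.{u} :=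
  (restrict h).quotient

/-- The projection `A → A / B`. -/
def subproj {A B : NormalSubobject X} (h : B ≤ A) : A.toSimplicialGroup ⟶ subquotient h :=
  (restrict h).proj

/-- The canonical morphism `A / B → A' / B'`, for `A ≤ A'` and `B ≤ B'`. -/
def subquotientMap {A B A' B' : NormalSubobject X} (h : B ≤ A) (h' : B' ≤ A')
    (hA : A ≤ A') (hB : B ≤ B') : subquotient h ⟶ subquotient h' :=
  (restrict h).desc (inclusion hA ≫ subproj h') fun k x hx => by
    have hx' : (x.1 : X.obj k) ∈ B.carrier k := hx
    rw [mem_ker]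
    exact ((restrict h').proj_eq_one_iff (x := Subgroup.inclusion (hA k) x)).2 (hB k hx')

end NormalSubobject

/-! ### The reflection onto the simplicial groups with bounded above Moore complex -/

/-- The property, for a simplicial group, that its Moore complex is trivial in degrees greater
than `n`. -/
def mooreBounded (n : ℕ) : ObjectProperty SimplicialGroup.{u} :=
  fun X => ∀ i, n < i → X.moore i = ⊥

open NormalSubobject

/-- The smallest normal simplicial subgroup of `X` such that the Moore complex of the quotient is
trivial in degrees greater than `n`. -/
def cotKernel (n : ℕ) (X : SimplicialGroup.{u}) : NormalSubobject X where
  carrier k := ⨅ A : { A : NormalSubobject X // mooreBounded n A.quotient }, A.1.carrier k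
  normal k := Subgroup.normal_iInf_normal fun A => A.1.normal k
  map_mem f x hx := by
    rw [Subgroup.mem_iInf] at hx ⊢
    exact fun A => A.1.map_mem f (hx A)

lemma cotKernel_le (n : ℕ) {X : SimplicialGroup.{u}} (A : NormalSubobject X)
    (hA : mooreBounded n A.quotient) : X.cotKernel n ≤ A :=
  fun k => iInf_le (fun A : { A : NormalSubobject X // mooreBounded n A.quotient } =>
    A.1.carrier k) ⟨A, hA⟩

lemma mooreBounded_of_injective {n : ℕ} {X Y : SimplicialGroup.{u}} (f : X ⟶ Y)
    (hf : ∀ k, Function.Injective (f.app k).hom) (hY : mooreBounded n Y) : mooreBounded n X := by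
  intro i hi
  rw [Subgroup.eq_bot_iff_forall]
  intro x hx
  have h := map_mem_moore f hx
  rw [hY i hi, Subgroup.mem_bot] at h
  exact hf _ (h.trans (map_one _).symm)

lemma mooreBounded_quotient_ker {n : ℕ} {X Y : SimplicialGroup.{u}} (f : X ⟶ Y)
    (hY : mooreBounded n Y) : mooreBounded n (ker f).quotient := by
  refine mooreBounded_of_injective ((ker f).desc f le_rfl) (fun k => ?_) hY
  rw [injective_iff_map_eq_one]
  intro x hx
  obtain ⟨x, rfl⟩ := (ker f).proj_surjective k x
  exact (proj_eq_one_iff _).2 (mem_ker.2 hx)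

lemma mooreBounded_quotient_cotKernel (n : ℕ) (X : SimplicialGroup.{u}) :
    mooreBounded n (X.cotKernel n).quotient := by
  intro i hi
  rw [Subgroup.eq_bot_iff_forall]
  intro x hx
  obtain ⟨x, rfl⟩ := (X.cotKernel n).proj_surjective _ x
  rw [proj_eq_one_iff]
  refine Subgroup.mem_iInf.2 fun A => ?_
  have h := map_mem_moore ((X.cotKernel n).desc A.1.proj fun k y hy =>
    mem_ker.2 ((proj_eq_one_iff _).2 (cotKernel_le n A.1 A.2 k hy))) hx
  rw [A.2 i hi, Subgroup.mem_bot] at h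
  exact (proj_eq_one_iff _).1 h

/-- Morphisms from `X / cotKernel` to a simplicial group `Y` with Moore complex trivial in degrees
greater than `n` are the same as morphisms from `X` to `Y`. -/
def cotHomEquiv (n : ℕ) (X : SimplicialGroup.{u}) (Y : (mooreBounded.{u} n).FullSubcategory) :
    ((⟨(X.cotKernel n).quotient, mooreBounded_quotient_cotKernel n X⟩ :
      (mooreBounded.{u} n).FullSubcategory) ⟶ Y) ≃ (X ⟶ (mooreBounded n).ι.obj Y) where
  toFun f := (X.cotKernel n).proj ≫ f.hom
  invFun f := ⟨(X.cotKernel n).desc f (cotKernel_le n _ (mooreBounded_quotient_ker f Y.2))⟩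
  left_inv f := by
    ext : 1
    exact hom_ext_of_surjective _ (proj_surjective _) rfl
  right_inv f := rfl

/-- The cotruncation functor `Cot_n`, the reflector onto the full subcategory of the simplicial
groups with Moore complex trivial in degrees greater than `n`. -/
def cot (n : ℕ) : SimplicialGroup.{u} ⥤ (mooreBounded.{u} n).FullSubcategory :=
  Adjunction.leftAdjointOfEquiv (cotHomEquiv n) fun _ _ _ _ _ => rfl

/-- The functor `Cot_n` is left adjoint to the inclusion functor. -/
def cotAdj (n : ℕ) : cot.{u} n ⊣ (mooreBounded n).ι :=
  Adjunction.adjunctionOfEquivLeft (cotHomEquiv n) fun _ _ _ _ _ => rfl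

/-! ### The radicals and the fundamental simplicial groups -/

/-- The radical `μ_{n ≥}`: the kernel of the unit `X → Cot_n(X)`. -/
def radLE (n : ℕ) (X : SimplicialGroup.{u}) : NormalSubobject X :=
  ker ((cotAdj n).unit.app X)

/-- The radical `μ_{≥ n}`. For `n ≥ 1` it is the kernel of the unit `X → Cosk_{n-1}(X)` of the
adjunction between the truncation functor and the coskeleton functor; for `n = 0`, it is `X`. -/
noncomputable def radGE (n : ℕ) (X : SimplicialGroup.{u}) : NormalSubobject X :=
  match n with
  | 0 => ⊤
  | n + 1 => ker ((SimplicialObject.coskAdj (C := GrpCat.{u}) n).unit.app X)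

lemma radLE_eq (n : ℕ) (X : SimplicialGroup.{u}) : radLE n X = X.cotKernel n := by
  have h : (cotAdj n).unit.app X = (X.cotKernel n).proj := by
    simp only [cotAdj, Adjunction.adjunctionOfEquivLeft, Adjunction.mkOfHomEquiv_unit_app]
    rfl
  rw [radLE, h]
  ext k x
  exact proj_eq_one_iff (X.cotKernel n)

lemma mem_radLE_of_faces {n : ℕ} {X : SimplicialGroup.{u}} {k : ℕ} (hk : n ≤ k) {x : X _⦋k + 1⦌}
    (hx : ∀ j : Fin (k + 2), (X.δ (n := k) j).hom x ∈ (radLE n X).carrier (op ⦋k⦌)) :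
    x ∈ (radLE n X).carrier (op ⦋k + 1⦌) := by
  have h : ((((cotAdj n).unit.app X).app (op ⦋k + 1⦌)).hom x) ∈
      ((mooreBounded n).ι.obj ((cot n).obj X)).moore (k + 1) := by
    rw [mem_moore_succ]
    intro j
    rw [map_δ]
    exact mem_ker.1 (hx _)
  have hb : ((mooreBounded n).ι.obj ((cot n).obj X)).moore (k + 1) = ⊥ :=
    ((cot n).obj X).property (k + 1) (by omega)
  rw [hb, Subgroup.mem_bot] at h
  exact mem_ker.2 h

lemma eq_one_of_mem_radGE {n : ℕ} {X : SimplicialGroup.{u}} {k : ℕ} (hk : k ≤ n) {x : X _⦋k⦌}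
    (hx : x ∈ (radGE (n + 1) X).carrier (op ⦋k⦌)) : x = 1 := by
  have h := (SimplicialObject.coskAdj (C := GrpCat.{u}) n).left_triangle_components X
  have h' := congrArg (fun φ => φ.app (op ⟨⦋k⦌, hk⟩)) h
  have h2 := ConcreteCategory.congr_hom h' x
  have hx' := mem_ker.1 hx
  refine h2.symm.trans ?_
  exact (congrArg (((SimplicialObject.coskAdj (C := GrpCat.{u}) n).counit.app
    ((SimplicialObject.truncation n).obj X)).app (op ⟨⦋k⦌, hk⟩)).hom hx').trans (map_one _)

/-- `μ_{≥ m} ≤ μ_{n ≥}` for `n < m`. -/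
lemma radGE_le_radLE {n m : ℕ} (h : n < m) (X : SimplicialGroup.{u}) :
    radGE m X ≤ radLE n X := by
  obtain ⟨m, rfl⟩ : ∃ k, m = k + 1 := ⟨m - 1, by omega⟩
  intro k
  induction k using Opposite.rec with
  | op k =>
    induction k using SimplexCategory.rec with | _ k
    induction k with
    | zero =>
      intro x hx
      rw [eq_one_of_mem_radGE (Nat.zero_le _) hx]
      exact one_mem _
    | succ k ih =>
      intro x hx
      by_cases hk : k + 1 ≤ m
      · rw [eq_one_of_mem_radGE hk hx]
        exact one_mem _
      · exact mem_radLE_of_faces (by omega) fun j => ih ((radGE (m + 1) X).map_mem _ hx)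

lemma cosk_ext {n : ℕ} {X : SimplicialGroup.{u}} {k : ℕ}
    {y : ((SimplicialObject.cosk n).obj X : SimplicialGroup.{u}) _⦋k⦌}
    (hy : ∀ (j : ℕ) (_ : j ≤ n) (f : ⦋j⦌ ⟶ ⦋k⦌),
      (((SimplicialObject.cosk n).obj X).map f.op).hom y = 1) : y = 1 := by
  have hl := (Functor.isPointwiseRightKanExtensionOfIsRightKanExtension
    ((SimplicialObject.cosk n).obj X)
    ((SimplicialObject.coskAdj (C := GrpCat.{u}) n).counit.app
      ((SimplicialObject.truncation n).obj X))) (op ⦋k⦌)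
  refine Limits.Concrete.isLimit_ext _ hl _ _ fun s => ?_
  obtain ⟨⟨⟨i, hi⟩⟩, f, rfl⟩ := s.mk_surjective
  induction i using SimplexCategory.rec with | _ i
  let c := (((SimplicialObject.coskAdj (C := GrpCat.{u}) n).counit.app
    ((SimplicialObject.truncation n).obj X)).app (op ⟨⦋i⦌, hi⟩)).hom
  have h1 : (((SimplicialObject.cosk n).obj X).map f).hom y = 1 := hy i hi f.unop
  have h2 : (((SimplicialObject.cosk n).obj X).map f).hom 1 = 1 := map_one _
  exact congrArg c (h1.trans h2.symm)

lemma mooreBounded_cosk (n : ℕ) (X : SimplicialGroup.{u}) :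
    mooreBounded (n + 1) ((SimplicialObject.cosk n).obj X) := by
  intro i hi
  obtain ⟨i, rfl⟩ : ∃ k, i = k + 1 := ⟨i - 1, by omega⟩
  rw [Subgroup.eq_bot_iff_forall]
  intro y hy
  rw [mem_moore_succ] at hy
  refine cosk_ext fun j hj f => ?_
  obtain ⟨a, ha⟩ : ∃ a : Fin (i + 1), ∀ x, f.toOrderHom x ≠ a.castSucc := by
    by_contra! hc
    choose g hg using hc
    have hg' : Function.Injective g := fun a b hab => by
      have := hg a
      rw [hab, hg b] at this
      exact (Fin.castSucc_injective _ this).symm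
    have := Fintype.card_le_of_injective g hg'
    simp at this
    omega
  obtain ⟨g, rfl⟩ := SimplexCategory.eq_comp_δ_of_not_surjective' f _ ha
  rw [op_comp, Functor.map_comp]
  exact (congrArg (((SimplicialObject.cosk n).obj X).map g.op).hom (hy a)).trans (map_one _)

/-- `μ_{m ≥} ≤ μ_{≥ n}` for `n ≤ m`. -/
lemma radLE_le_radGE {n m : ℕ} (h : n ≤ m) (X : SimplicialGroup.{u}) :
    radLE m X ≤ radGE n X := by
  cases n with
  | zero => exact le_top' _
  | succ n =>
    rw [radLE_eq]
    exact cotKernel_le m _ (mooreBounded_quotient_ker _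
      fun i hi => mooreBounded_cosk n X i (by omega))

/-- `μ_{≥ m} ≤ μ_{≥ n}` for `n ≤ m`. -/
lemma radGE_le_radGE {n m : ℕ} (h : n ≤ m) (X : SimplicialGroup.{u}) :
    radGE m X ≤ radGE n X := by
  obtain rfl | h := h.eq_or_lt
  · exact le_rfl
  · exact (radGE_le_radLE h X).trans (radLE_le_radGE le_rfl X)

/-- `μ_{m ≥} ≤ μ_{n ≥}` for `n ≤ m`. -/
lemma radLE_le_radLE {n m : ℕ} (h : n ≤ m) (X : SimplicialGroup.{u}) :
    radLE m X ≤ radLE n X := by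
  obtain rfl | h := h.eq_or_lt
  · exact le_rfl
  · exact (radLE_le_radGE le_rfl X).trans (radGE_le_radLE h X)

/-- `Π^{n ≥}(X) = μ_{n ≥}(X)`. -/
abbrev PiUpLE (n : ℕ) (X : SimplicialGroup.{u}) : SimplicialGroup.{u} :=
  (radLE n X).toSimplicialGroup

/-- `Π^{≥ n}(X) = μ_{≥ n}(X)`. -/
noncomputable abbrev PiUpGE (n : ℕ) (X : SimplicialGroup.{u}) : SimplicialGroup.{u} :=
  (radGE n X).toSimplicialGroup

/-- `Π_{n ≥}(X) = X / μ_{n ≥}(X)`. -/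
abbrev PiDownLE (n : ℕ) (X : SimplicialGroup.{u}) : SimplicialGroup.{u} :=
  (radLE n X).quotient

/-- `Π_{≥ n}(X) = X / μ_{≥ n}(X)`. -/
noncomputable abbrev PiDownGE (n : ℕ) (X : SimplicialGroup.{u}) : SimplicialGroup.{u} :=
  (radGE n X).quotient

/-- `Π^{n ≥}_{≥ m}(X) = μ_{n ≥}(X) / μ_{≥ m}(X)`, for `n < m`. -/
noncomputable abbrev PiLEGE {n m : ℕ} (h : n < m) (X : SimplicialGroup.{u}) :
    SimplicialGroup.{u} :=
  subquotient (radGE_le_radLE h X)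

/-- `Π^{n ≥}_{m ≥}(X) = μ_{n ≥}(X) / μ_{m ≥}(X)`, for `n ≤ m`. -/
abbrev PiLELE {n m : ℕ} (h : n ≤ m) (X : SimplicialGroup.{u}) : SimplicialGroup.{u} :=
  subquotient (radLE_le_radLE h X)

/-- `Π^{≥ n}_{≥ m}(X) = μ_{≥ n}(X) / μ_{≥ m}(X)`, for `n ≤ m`. -/
noncomputable abbrev PiGEGE {n m : ℕ} (h : n ≤ m) (X : SimplicialGroup.{u}) :
    SimplicialGroup.{u} :=
  subquotient (radGE_le_radGE h X)

/-- `Π^{≥ n}_{m ≥}(X) = μ_{≥ n}(X) / μ_{m ≥}(X)`, for `n ≤ m`. -/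
noncomputable abbrev PiGELE {n m : ℕ} (h : n ≤ m) (X : SimplicialGroup.{u}) :
    SimplicialGroup.{u} :=
  subquotient (radLE_le_radGE h X)

/-- The canonical morphism `Π^{n ≥}_{≥ m+1}(X) → Π^{n ≥}_{m ≥}(X)`, for `n < m`. -/
noncomputable def piLEGEToLELE {n m : ℕ} (h : n < m) (X : SimplicialGroup.{u}) :
    PiLEGE (h.trans m.lt_succ_self) X ⟶ PiLELE h.le X :=
  subquotientMap _ _ le_rfl (radGE_le_radLE m.lt_succ_self X)

/-- The canonical morphism `Π^{≥ n+1}_{≥ m+1}(X) → Π^{n ≥}_{≥ m+1}(X)`, for `n < m`. -/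
noncomputable def piGEGEToLEGE {n m : ℕ} (h : n < m) (X : SimplicialGroup.{u}) :
    PiGEGE (Nat.succ_le_succ h.le) X ⟶ PiLEGE (h.trans m.lt_succ_self) X :=
  subquotientMap _ _ (radGE_le_radLE n.lt_succ_self X) le_rfl

/-- The canonical morphism `Π^{≥ n+1}_{≥ m+1}(X) → Π^{≥ n+1}_{m ≥}(X)`, for `n < m`. -/
noncomputable def piGEGEToGELE {n m : ℕ} (h : n < m) (X : SimplicialGroup.{u}) :
    PiGEGE (Nat.succ_le_succ h.le) X ⟶ PiGELE (Nat.succ_le_of_lt h) X :=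
  subquotientMap _ _ le_rfl (radGE_le_radLE m.lt_succ_self X)

/-- The canonical morphism `Π^{≥ n+1}_{m ≥}(X) → Π^{n ≥}_{m ≥}(X)`, for `n < m`. -/
noncomputable def piGELEToLELE {n m : ℕ} (h : n < m) (X : SimplicialGroup.{u}) :
    PiGELE (Nat.succ_le_of_lt h) X ⟶ PiLELE h.le X :=
  subquotientMap _ _ (radGE_le_radLE n.lt_succ_self X) le_rfl

end SimplicialGroup

/-! Every claim follows from the long exact homotopy sequence of a short exact sequence of
simplicial groups, once the homotopy of the two radicals and of their quotients is known. The
sequence is available because surjections of simplicial groups stay surjective on Moore complexes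
(`exists_mem_moore`), which rests on horn filling inside the kernel
(`NormalSubobject.exists_filler`).

The radical `radGE (n + 1) X` is trivial in degrees at most `n`, and its quotient embeds in a
coskeleton, so only `π_{n+1}` of the quotient needs an argument: the radical contains all cycles of
degree `n + 1`. The quotient by `radLE n X` has Moore complex zero above `n`. The radical itself is
trivial below `n` and consists of boundaries in degree `n`, because it lies in `boundariesHull n X`;
those boundaries already bound inside the radical.

Hence both radicals carry exactly the homotopy of `X` above degree `n`, and `μ_{n ≥} / μ_{≥ n+1}` is
acyclic. The comparison maps between the four mixed quotients have such an acyclic group as kernel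
or cokernel. -/

namespace SimplicialGroup

open NormalSubobject

/-! ### Elementwise criteria for homotopy groups and their maps -/

section Homotopy

variable {X Y : SimplicialGroup.{u}}

lemma subsingleton_homotopyGroup_iff {i : ℕ} :
    Subsingleton (homotopyGroup i X) ↔ X.cycles i ≤ X.boundaries i := by
  rw [QuotientGroup.subsingleton_iff, Subgroup.subgroupOf_eq_top]

lemma homotopyGroupMap_injective_iff {i : ℕ} {f : X ⟶ Y} :
    Function.Injective (homotopyGroupMap i f) ↔
      ∀ x ∈ X.cycles i, (f.app (op ⦋i⦌)).hom x ∈ Y.boundaries i → x ∈ X.boundaries i := by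
  rw [injective_iff_map_eq_one]
  constructor
  · intro h x hx hfx
    exact Subgroup.mem_subgroupOf.1 ((QuotientGroup.eq_one_iff _).1
      (h (QuotientGroup.mk ⟨x, hx⟩)
        ((QuotientGroup.eq_one_iff _).2 (Subgroup.mem_subgroupOf.2 hfx))))
  · intro h x hx
    obtain ⟨x, rfl⟩ := QuotientGroup.mk_surjective x
    exact (QuotientGroup.eq_one_iff _).2 (Subgroup.mem_subgroupOf.2
      (h x x.2 (Subgroup.mem_subgroupOf.1 ((QuotientGroup.eq_one_iff _).1 hx))))

lemma homotopyGroupMap_surjective_iff {i : ℕ} {f : X ⟶ Y} :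
    Function.Surjective (homotopyGroupMap i f) ↔
      ∀ y ∈ Y.cycles i, ∃ x ∈ X.cycles i, ((f.app (op ⦋i⦌)).hom x)⁻¹ * y ∈ Y.boundaries i := by
  constructor
  · intro h y hy
    obtain ⟨x, hx⟩ := h (QuotientGroup.mk ⟨y, hy⟩)
    obtain ⟨x, rfl⟩ := QuotientGroup.mk_surjective x
    exact ⟨x, x.2, Subgroup.mem_subgroupOf.1 (QuotientGroup.eq.1 hx)⟩
  · intro h y
    obtain ⟨y, rfl⟩ := QuotientGroup.mk_surjective y
    obtain ⟨x, hx, hxy⟩ := h y y.2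
    exact ⟨QuotientGroup.mk ⟨x, hx⟩, QuotientGroup.eq.2 (Subgroup.mem_subgroupOf.2 hxy)⟩

lemma homotopyGroupMap_comp (i : ℕ) {Z : SimplicialGroup.{u}} (f : X ⟶ Y) (g : Y ⟶ Z) :
    ⇑(homotopyGroupMap i (f ≫ g)) = homotopyGroupMap i g ∘ homotopyGroupMap i f := by
  funext x
  obtain ⟨x, rfl⟩ := QuotientGroup.mk_surjective x
  rfl

lemma cycles_le_moore (X : SimplicialGroup.{u}) (i : ℕ) : X.cycles i ≤ X.moore i := by
  cases i with
  | zero => exact le_rfl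
  | succ i => exact inf_le_left

lemma mem_cycles_succ_iff {n : ℕ} {x : X _⦋n + 1⦌} :
    x ∈ X.cycles (n + 1) ↔
      x ∈ X.moore (n + 1) ∧ (X.δ (n := n) (Fin.last (n + 1))).hom x = 1 := Iff.rfl

lemma δ_last_mem_cycles {n : ℕ} {x : X _⦋n + 1⦌} (hx : x ∈ X.moore (n + 1)) :
    (X.δ (n := n) (Fin.last (n + 1))).hom x ∈ X.cycles n :=
  X.boundaries_le_cycles n (mem_boundaries.2 ⟨x, hx, rfl⟩)

/-- An injective morphism reflects membership in the Moore complex. -/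
lemma mem_moore_of_map {f : X ⟶ Y} (hf : ∀ k, Function.Injective (f.app k).hom) {n : ℕ}
    {x : X _⦋n⦌} (hx : (f.app (op ⦋n⦌)).hom x ∈ Y.moore n) : x ∈ X.moore n := by
  cases n with
  | zero => exact Subgroup.mem_top _
  | succ n =>
    rw [mem_moore_succ] at hx ⊢
    intro j
    exact hf _ (by rw [← map_δ, hx j, map_one])

lemma mem_cycles_of_map {f : X ⟶ Y} (hf : ∀ k, Function.Injective (f.app k).hom) {n : ℕ}
    {x : X _⦋n⦌} (hx : (f.app (op ⦋n⦌)).hom x ∈ Y.cycles n) : x ∈ X.cycles n := by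
  cases n with
  | zero => exact Subgroup.mem_top _
  | succ n =>
    rw [mem_cycles_succ] at hx ⊢
    intro j
    exact hf _ (by rw [← map_δ, hx j, map_one])

/-! ### Horn filling in a normal simplicial subgroup -/

/-- Fillers for the horns which miss the last face, in a normal simplicial subgroup. -/
lemma NormalSubobject.exists_filler (A : NormalSubobject X) {n : ℕ} (x : X _⦋n + 1⦌)
    (hx : ∀ j : Fin (n + 1), (X.δ (n := n) j.castSucc).hom x ∈ A.carrier (op ⦋n⦌)) :
    ∃ y ∈ A.carrier (op ⦋n + 1⦌),
      ∀ j : Fin (n + 1), (X.δ (n := n) j.castSucc).hom y = (X.δ (n := n) j.castSucc).hom x := by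
  suffices h : ∀ k ≤ n + 1, ∃ y ∈ A.carrier (op ⦋n + 1⦌), ∀ j : Fin (n + 1), j.1 < k →
      (X.δ (n := n) j.castSucc).hom y = (X.δ (n := n) j.castSucc).hom x by
    obtain ⟨y, hy, h⟩ := h (n + 1) le_rfl
    exact ⟨y, hy, fun j => h j j.2⟩
  -- The faces are matched one at a time: `y` agrees with `x` on the faces of index less than `k`.
  intro k
  induction k with
  | zero => exact fun _ => ⟨1, one_mem _, fun j hj => absurd hj (Nat.not_lt_zero _)⟩
  | succ k ih =>
    intro hk
    obtain ⟨y, hy, h⟩ := ih (by omega)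
    let κ : Fin (n + 1) := ⟨k, hk⟩
    let v : X _⦋n⦌ := (X.δ (n := n) κ.castSucc).hom (y⁻¹ * x)
    have hv : v ∈ A.carrier (op ⦋n⦌) := by
      simp only [v, map_mul, map_inv]
      exact mul_mem (inv_mem (A.map_mem _ hy)) (hx κ)
    -- The degenerate factor repairs face `k`, since `d_k s_k v = v`. It leaves face `j < k` alone:
    -- `d_j s_k v = s_{k-1} d_j v`, and `d_j v = d_{k-1} d_j (y⁻¹ x) = 1` by the induction
    -- hypothesis.
    refine ⟨y * (X.σ (n := n) κ).hom v, mul_mem hy (A.map_mem _ hv), fun j hj => ?_⟩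
    rw [map_mul]
    obtain hj | hj := (Nat.lt_succ_iff.1 hj).lt_or_eq
    · have hjκ : j < κ := hj
      have e : (X.δ (n := n) j.castSucc).hom ((X.σ (n := n) κ).hom v) = 1 := by
        obtain ⟨m, rfl⟩ : ∃ m, n = m + 1 := ⟨n - 1, by omega⟩
        obtain ⟨l, hl⟩ : ∃ l : Fin (m + 1), κ = l.succ :=
          ⟨⟨k - 1, by omega⟩, Fin.ext (show k = k - 1 + 1 by omega)⟩
        have hjl : j ≤ l.castSucc := by
          rw [hl] at hjκ
          exact Fin.le_castSucc_iff.2 hjκ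
        have h1 := ConcreteCategory.congr_hom (X.δ_comp_σ_of_le hjl) v
        have h2 := ConcreteCategory.congr_hom (X.δ_comp_δ hjl) (y⁻¹ * x)
        have h3 : (X.δ (n := m + 1) j.castSucc).hom (y⁻¹ * x) = 1 := by
          rw [map_mul, map_inv, h _ hj, inv_mul_cancel]
        have h4 : (X.δ j).hom v = 1 := by
          simp only [v, hl]
          exact h2.trans ((congrArg (X.δ l.castSucc).hom h3).trans (map_one _))
        rw [hl]
        exact h1.trans ((congrArg (X.σ l).hom h4).trans (map_one _))
      rw [e, mul_one, h j hj]
    · obtain rfl : j = κ := Fin.ext hj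
      have e : (X.δ (n := n) κ.castSucc).hom ((X.σ (n := n) κ).hom v) = v :=
        ConcreteCategory.congr_hom (X.δ_comp_σ_self (n := n) (i := κ)) v
      rw [e]
      simp [v]

/-! ### Pieces of the long exact homotopy sequence -/

/-- A short exact sequence of simplicial groups. -/
structure IsShortExact {A B C : SimplicialGroup.{u}} (f : A ⟶ B) (g : B ⟶ C) : Prop where
  injective : ∀ k, Function.Injective (f.app k).hom
  surjective : ∀ k, Function.Surjective (g.app k).hom
  exact : ∀ k (y : B.obj k), (g.app k).hom y = 1 ↔ ∃ x, (f.app k).hom x = y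

namespace IsShortExact

variable {A B C : SimplicialGroup.{u}} {f : A ⟶ B} {g : B ⟶ C}

lemma map_map (h : IsShortExact f g) {k : SimplexCategoryᵒᵖ} (x : A.obj k) :
    (g.app k).hom ((f.app k).hom x) = 1 := (h.exact k _).2 ⟨x, rfl⟩

/-- An arbitrary lift has all but its last face in the kernel of `g`; dividing by a filler from that
kernel makes these faces trivial without changing the image. -/
lemma exists_mem_moore (h : IsShortExact f g) {n : ℕ} {z : C _⦋n⦌} (hz : z ∈ C.moore n) :
    ∃ y ∈ B.moore n, (g.app (op ⦋n⦌)).hom y = z := by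
  obtain ⟨y, rfl⟩ := h.surjective _ z
  cases n with
  | zero => exact ⟨y, Subgroup.mem_top _, rfl⟩
  | succ n =>
    rw [mem_moore_succ] at hz
    obtain ⟨w, hw, hwy⟩ := (ker g).exists_filler y fun j => by
      rw [mem_ker, ← map_δ, hz j]
    refine ⟨y * w⁻¹, mem_moore_succ.2 fun j => ?_, ?_⟩
    · rw [map_mul, map_inv, hwy, mul_inv_cancel]
    · rw [map_mul, map_inv, mem_ker.1 hw, inv_one, mul_one]

/-- An element of the Moore complex of `B` whose image in `C` is the image of the boundary of
an element of the Moore complex of `C` comes from `A`, up to a boundary. -/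
lemma exists_of_mem_boundaries (h : IsShortExact f g) {n : ℕ} {y : B _⦋n⦌}
    (hy : y ∈ B.moore n) (hgy : (g.app (op ⦋n⦌)).hom y ∈ C.boundaries n) :
    ∃ x ∈ A.moore n, ((f.app (op ⦋n⦌)).hom x)⁻¹ * y ∈ B.boundaries n := by
  obtain ⟨z, hz, hzy⟩ := mem_boundaries.1 hgy
  obtain ⟨w, hw, rfl⟩ := h.exists_mem_moore hz
  rw [map_δ] at hzy
  obtain ⟨x, hx⟩ := (h.exact _ (y * ((B.δ (Fin.last (n + 1))).hom w)⁻¹)).1 (by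
    rw [map_mul, map_inv, hzy, mul_inv_cancel])
  refine ⟨x, mem_moore_of_map h.injective ?_, ?_⟩
  · rw [hx]
    exact mul_mem hy (inv_mem (B.cycles_le_moore n (δ_last_mem_cycles hw)))
  · rw [hx, mul_inv_rev, inv_inv, inv_mul_cancel_right]
    exact mem_boundaries.2 ⟨w, hw, rfl⟩

/-- Exactness at `π_n(B)`: the element from `A` differs from the cycle `y` by a boundary, so it is
itself a cycle. -/
lemma exists_cycle_of_mem_boundaries (h : IsShortExact f g) {n : ℕ} {y : B _⦋n⦌}
    (hy : y ∈ B.cycles n) (hgy : (g.app (op ⦋n⦌)).hom y ∈ C.boundaries n) :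
    ∃ x ∈ A.cycles n, ((f.app (op ⦋n⦌)).hom x)⁻¹ * y ∈ B.boundaries n := by
  obtain ⟨x, -, hx⟩ := h.exists_of_mem_boundaries (B.cycles_le_moore n hy) hgy
  refine ⟨x, mem_cycles_of_map h.injective ?_, hx⟩
  have := mul_mem hy (inv_mem (B.boundaries_le_cycles n hx))
  rwa [mul_inv_rev, inv_inv, mul_inv_cancel_left] at this

lemma map_surjective (h : IsShortExact f g) {i : ℕ}
    (hC : Subsingleton (homotopyGroup i C)) : Function.Surjective (homotopyGroupMap i f) :=
  homotopyGroupMap_surjective_iff.2 fun _ hy => h.exists_cycle_of_mem_boundaries hy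
    (subsingleton_homotopyGroup_iff.1 hC (map_mem_cycles g hy))

lemma map_injective_right (h : IsShortExact f g) {i : ℕ}
    (hA : Subsingleton (homotopyGroup i A)) : Function.Injective (homotopyGroupMap i g) :=
  homotopyGroupMap_injective_iff.2 fun y hy hgy => by
    obtain ⟨x, hx, hxy⟩ := h.exists_cycle_of_mem_boundaries hy hgy
    have := mul_mem (map_mem_boundaries f (subsingleton_homotopyGroup_iff.1 hA hx)) hxy
    rwa [mul_inv_cancel_left] at this

lemma map_surjective_right_zero (h : IsShortExact f g) :
    Function.Surjective (homotopyGroupMap 0 g) :=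
  homotopyGroupMap_surjective_iff.2 fun z _ => by
    obtain ⟨y, rfl⟩ := h.surjective _ z
    exact ⟨y, Subgroup.mem_top _, by rw [inv_mul_cancel]; exact one_mem _⟩

/-- The connecting map is trivial: a Moore lift `y` of a cycle has last face `f a`, where `f a`
bounds in `B`. Injectivity makes `a` the boundary of some `w`, and `y (f w)⁻¹` is then a cycle
lifting the given one. -/
lemma map_surjective_right_succ (h : IsShortExact f g) {i : ℕ}
    (hf : Function.Injective (homotopyGroupMap i f)) :
    Function.Surjective (homotopyGroupMap (i + 1) g) :=
  homotopyGroupMap_surjective_iff.2 fun z hz => by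
    obtain ⟨y, hy, rfl⟩ := h.exists_mem_moore (C.cycles_le_moore _ hz)
    obtain ⟨a, ha⟩ := (h.exact _ ((B.δ (Fin.last (i + 1))).hom y)).1 (by
      rw [← map_δ]; exact (mem_cycles_succ_iff.1 hz).2)
    have ha' : a ∈ A.boundaries i := homotopyGroupMap_injective_iff.1 hf a
      (mem_cycles_of_map h.injective (ha ▸ δ_last_mem_cycles hy))
      (ha ▸ mem_boundaries.2 ⟨y, hy, rfl⟩)
    obtain ⟨w, hw, rfl⟩ := mem_boundaries.1 ha'
    rw [← map_δ] at ha
    refine ⟨y * ((f.app (op ⦋i + 1⦌)).hom w)⁻¹, mem_cycles_succ_iff.2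
      ⟨mul_mem hy (inv_mem (map_mem_moore f hw)), ?_⟩, ?_⟩
    · rw [map_mul, map_inv, ha, mul_inv_cancel]
    · rw [map_mul, map_inv, h.map_map, inv_one, mul_one, inv_mul_cancel]
      exact one_mem _

lemma map_injective (h : IsShortExact f g) {i : ℕ}
    (hg : Function.Surjective (homotopyGroupMap (i + 1) g)) :
    Function.Injective (homotopyGroupMap i f) :=
  homotopyGroupMap_injective_iff.2 fun a ha hfa => by
    obtain ⟨y, hy, hya⟩ := mem_boundaries.1 hfa
    have hgy : (g.app (op ⦋i + 1⦌)).hom y ∈ C.cycles (i + 1) :=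
      mem_cycles_succ_iff.2 ⟨map_mem_moore g hy, by rw [map_δ, hya, h.map_map]⟩
    -- Dividing `y` by the cycle `w` keeps its last face `f a`, and makes its image in `C` a
    -- boundary, so that it comes from some `x` in `A` up to a boundary. The last face of `x` is
    -- then `a`.
    obtain ⟨w, hw, hwy⟩ := homotopyGroupMap_surjective_iff.1 hg _ hgy
    rw [← map_inv, ← map_mul] at hwy
    obtain ⟨x, hx, hxy⟩ := h.exists_of_mem_boundaries
      (mul_mem (inv_mem (B.cycles_le_moore _ hw)) hy) hwy
    refine mem_boundaries.2 ⟨x, hx, h.injective _ ?_⟩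
    have h1 := (mem_cycles_succ_iff.1 (B.boundaries_le_cycles _ hxy)).2
    rw [map_mul, map_mul, map_inv, map_inv, (mem_cycles_succ_iff.1 hw).2, hya, map_δ, inv_one,
      one_mul, inv_mul_eq_one] at h1
    exact h1

lemma map_bijective (h : IsShortExact f g) {i : ℕ} (hC : Subsingleton (homotopyGroup i C))
    (hC' : Subsingleton (homotopyGroup (i + 1) C)) :
    Function.Bijective (homotopyGroupMap i f) :=
  ⟨h.map_injective fun _ => ⟨1, Subsingleton.elim _ _⟩, h.map_surjective hC⟩

/-- The conditions on `k` select the degrees `i` and `i - 1`, with nothing required below degree 0.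
-/
lemma map_bijective_right (h : IsShortExact f g) {i : ℕ}
    (hA : ∀ k, k ≤ i → i ≤ k + 1 → Subsingleton (homotopyGroup k A)) :
    Function.Bijective (homotopyGroupMap i g) := by
  refine ⟨h.map_injective_right (hA i le_rfl (Nat.le_succ i)), ?_⟩
  cases i with
  | zero => exact h.map_surjective_right_zero
  | succ i =>
    have := hA i (Nat.le_succ i) le_rfl
    exact h.map_surjective_right_succ (Function.injective_of_subsingleton _)

/-- Injectivity on `π_{i-1}` makes `π_i(g)` surjective, while surjectivity on `π_i` makes it
trivial, as `f ≫ g` is trivial. -/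
lemma subsingleton_right (h : IsShortExact f g) {i : ℕ}
    (hf : Function.Surjective (homotopyGroupMap i f))
    (hf' : ∀ k, i = k + 1 → Function.Injective (homotopyGroupMap k f)) :
    Subsingleton (homotopyGroup i C) := by
  have hg : Function.Surjective (homotopyGroupMap i g) := by
    cases i with
    | zero => exact h.map_surjective_right_zero
    | succ i => exact h.map_surjective_right_succ (hf' i rfl)
  refine subsingleton_of_forall_eq 1 fun z => ?_
  obtain ⟨y, rfl⟩ := hg z
  obtain ⟨x, rfl⟩ := hf y
  obtain ⟨x, rfl⟩ := QuotientGroup.mk_surjective x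
  have e : cyclesMap i g (cyclesMap i f x) = 1 := Subtype.ext (h.map_map x.1)
  exact congrArg QuotientGroup.mk e

end IsShortExact

end Homotopy

/-! ### Short exact sequences from normal simplicial subgroups -/

namespace NormalSubobject

variable {X : SimplicialGroup.{u}}

lemma isShortExact_proj (A : NormalSubobject X) : IsShortExact A.incl A.proj where
  injective _ := Subtype.val_injective
  surjective := A.proj_surjective
  exact _ y := (A.proj_eq_one_iff).trans ⟨fun h => ⟨⟨y, h⟩, rfl⟩, fun ⟨x, hx⟩ => hx ▸ x.2⟩

lemma subproj_surjective {A B : NormalSubobject X} (h : B ≤ A) (k : SimplexCategoryᵒᵖ) :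
    Function.Surjective ((subproj h).app k).hom := (restrict h).proj_surjective k

lemma subproj_eq_one_iff {A B : NormalSubobject X} (h : B ≤ A) {k : SimplexCategoryᵒᵖ}
    {x : A.carrier k} : ((subproj h).app k).hom x = 1 ↔ x.1 ∈ B.carrier k :=
  (restrict h).proj_eq_one_iff

lemma isShortExact_subproj {A B : NormalSubobject X} (h : B ≤ A) :
    IsShortExact (inclusion h) (subproj h) where
  injective k := Subgroup.inclusion_injective (h k)
  surjective := subproj_surjective h
  exact k y := (subproj_eq_one_iff h).trans
    ⟨fun hy => ⟨⟨y.1, hy⟩, rfl⟩, fun ⟨x, hx⟩ => by rw [← hx]; exact x.2⟩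

/-- The third isomorphism theorem, as the sequence `B / C → A / C → A / B`. -/
lemma isShortExact_subquotientMap {A B C : NormalSubobject X} (hBA : B ≤ A) (hCB : C ≤ B) :
    IsShortExact (subquotientMap hCB (hCB.trans hBA) hBA le_rfl)
      (subquotientMap (hCB.trans hBA) hBA le_rfl hCB) where
  injective k := by
    rw [injective_iff_map_eq_one]
    intro x hx
    obtain ⟨x, rfl⟩ := subproj_surjective _ k x
    exact (subproj_eq_one_iff hCB).2
      ((subproj_eq_one_iff (hCB.trans hBA) (x := Subgroup.inclusion (hBA k) x)).1 hx)
  surjective k z := by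
    obtain ⟨x, rfl⟩ := subproj_surjective _ k z
    exact ⟨((subproj (hCB.trans hBA)).app k).hom x, rfl⟩
  exact k y := by
    obtain ⟨x, rfl⟩ := subproj_surjective _ k y
    refine (subproj_eq_one_iff hBA (x := x)).trans
      ⟨fun hx => ⟨((subproj hCB).app k).hom ⟨x.1, hx⟩, rfl⟩, fun ⟨w, hw⟩ => ?_⟩
    obtain ⟨w, rfl⟩ := subproj_surjective _ k w
    have h1 := QuotientGroup.eq.1 hw
    have h2 : (w.1 : X.obj k)⁻¹ * x.1 ∈ C.carrier k := h1
    simpa using mul_mem w.2 (hCB k h2)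

end NormalSubobject

/-! ### Bounds on the radicals -/

section Radicals

variable {X : SimplicialGroup.{u}}

lemma map_comp_δ_eq_one {j k : ℕ} (g : ⦋j⦌ ⟶ ⦋k⦌) (a : Fin (k + 2)) {x : X _⦋k + 1⦌}
    (hx : (X.δ (n := k) a).hom x = 1) :
    (X.map (g ≫ SimplexCategory.δ a).op).hom x = 1 := by
  rw [op_comp, Functor.map_comp]
  exact (congrArg (X.map g.op).hom hx).trans (map_one _)

/-- A cycle is killed by the operators which are not surjective. -/
lemma map_eq_one_of_mem_cycles {j k : ℕ} (g : ⦋j⦌ ⟶ ⦋k⦌) (hg : ¬ Function.Surjective g.toOrderHom)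
    {x : X _⦋k⦌} (hx : x ∈ X.cycles k) : (X.map g.op).hom x = 1 := by
  cases k with
  | zero =>
    -- Every operator into `⦋0⦌` is surjective, so degree 0 contradicts `hg`.
    exact absurd (fun b => ⟨0, Subsingleton.elim (α := Fin 1) _ _⟩) hg
  | succ k =>
    obtain ⟨g, a, rfl⟩ : ∃ (g' : ⦋j⦌ ⟶ ⦋k⦌) (a : Fin (k + 2)), g = g' ≫ SimplexCategory.δ a := by
      obtain ⟨a, g', h⟩ := SimplexCategory.eq_comp_δ_of_not_surjective g hg
      exact ⟨g', a, h⟩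
    exact map_comp_δ_eq_one g a (mem_cycles_succ.1 hx a)

lemma not_surjective_of_lt {j k : ℕ} (g : ⦋j⦌ ⟶ ⦋k⦌) (h : j < k) :
    ¬ Function.Surjective g.toOrderHom := fun hg => by
  have := Fintype.card_le_of_surjective _ hg
  simp at this
  omega

/-- The boundaries of degree `n` of the Moore complex in degree `n`, and the trivial subgroup in
all other degrees. -/
def boundariesAt (n : ℕ) (X : SimplicialGroup.{u}) (j : ℕ) : Subgroup (X _⦋j⦌) :=
  if j = n then X.boundaries j else ⊥

instance (n : ℕ) (X : SimplicialGroup.{u}) (j : ℕ) : (boundariesAt n X j).Normal := by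
  unfold boundariesAt
  split_ifs <;> infer_instance

/-- A non-surjective operator kills boundaries, because they are cycles; a surjective one forces `j
= n = k` and is the identity. -/
lemma map_mem_boundariesAt {n j k : ℕ} (hj : j ≤ n) (hk : n ≤ k) (g : ⦋j⦌ ⟶ ⦋k⦌) {x : X _⦋k⦌}
    (hx : x ∈ X.boundaries k) : (X.map g.op).hom x ∈ boundariesAt n X j := by
  by_cases hg : Function.Surjective g.toOrderHom
  · obtain rfl : j = k := by
      by_contra h
      exact not_surjective_of_lt g (by omega) hg
    have := SimplexCategory.epi_iff_surjective.2 hg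
    rw [boundariesAt, if_pos (by omega), SimplexCategory.eq_id_of_epi g, op_id, X.map_id]
    exact hx
  · rw [map_eq_one_of_mem_cycles g hg (X.boundaries_le_cycles k hx)]
    exact one_mem _

/-- The largest normal simplicial subgroup of `X` which is trivial in degrees less than `n` and
contained in the boundaries in degree `n`. -/
def boundariesHull (n : ℕ) (X : SimplicialGroup.{u}) : NormalSubobject X where
  carrier k := ⨅ (j : ℕ) (_ : j ≤ n) (f : k ⟶ op ⦋j⦌), (boundariesAt n X j).comap (X.map f).hom
  normal k := Subgroup.normal_iInf_normal fun j => Subgroup.normal_iInf_normal fun _ =>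
    Subgroup.normal_iInf_normal fun _ => Subgroup.Normal.comap inferInstance _
  map_mem g x hx := by
    simp only [Subgroup.mem_iInf, Subgroup.mem_comap] at hx ⊢
    intro j hj f
    have h := hx j hj (g ≫ f)
    rwa [X.map_comp] at h

lemma mem_boundariesHull {n k : ℕ} {x : X _⦋k⦌} :
    x ∈ (boundariesHull n X).carrier (op ⦋k⦌) ↔
      ∀ j ≤ n, ∀ f : ⦋j⦌ ⟶ ⦋k⦌, (X.map f.op).hom x ∈ boundariesAt n X j := by
  simp only [boundariesHull, Subgroup.mem_iInf, Subgroup.mem_comap]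
  exact ⟨fun h j hj f => h j hj f.op, fun h j hj f => h j hj f.unop⟩

/-- An operator from degree at most `n` factors through a coface of `⦋k + 1⦌`. All faces of `x` but
the last are trivial, and the last is a boundary. -/
lemma moore_le_boundariesHull {n k : ℕ} (hk : n ≤ k) {x : X _⦋k + 1⦌} (hx : x ∈ X.moore (k + 1)) :
    x ∈ (boundariesHull n X).carrier (op ⦋k + 1⦌) := by
  refine mem_boundariesHull.2 fun j hj f => ?_
  obtain ⟨a, g, rfl⟩ := SimplexCategory.eq_comp_δ_of_not_surjective f
    (not_surjective_of_lt f (by omega))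
  induction a using Fin.lastCases with
  | last =>
    rw [op_comp, Functor.map_comp]
    exact map_mem_boundariesAt hj hk g (mem_boundaries.2 ⟨x, hx, rfl⟩)
  | cast a =>
    rw [map_comp_δ_eq_one g _ (mem_moore_succ.1 hx a)]
    exact one_mem _

/-- By minimality of `cotKernel` it suffices that the quotient by the hull has no Moore complex
above `n`. Its Moore elements lift to Moore elements of `X`, which lie in the hull. -/
lemma radLE_le_boundariesHull (n : ℕ) (X : SimplicialGroup.{u}) :
    radLE n X ≤ boundariesHull n X := by
  rw [radLE_eq]
  refine cotKernel_le n _ fun i hi => ?_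
  obtain ⟨k, rfl⟩ : ∃ k, i = k + 1 := ⟨i - 1, by omega⟩
  rw [Subgroup.eq_bot_iff_forall]
  intro z hz
  obtain ⟨x, hx, rfl⟩ := (boundariesHull n X).isShortExact_proj.exists_mem_moore hz
  exact (proj_eq_one_iff _).2 (moore_le_boundariesHull (by omega) hx)

lemma mem_boundariesAt_of_mem_radLE {n i : ℕ} (hi : i ≤ n) {x : X _⦋i⦌}
    (hx : x ∈ (radLE n X).carrier (op ⦋i⦌)) : x ∈ boundariesAt n X i := by
  have := mem_boundariesHull.1 (radLE_le_boundariesHull n X _ hx) i hi (𝟙 _)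
  rw [op_id, X.map_id] at this
  exact this

lemma mooreBounded_quotient_radLE (n : ℕ) (X : SimplicialGroup.{u}) :
    mooreBounded n (radLE n X).quotient := by
  rw [radLE_eq]
  exact mooreBounded_quotient_cotKernel n X

lemma mem_radLE_of_mem_moore {n i : ℕ} (hi : n < i) {x : X _⦋i⦌} (hx : x ∈ X.moore i) :
    x ∈ (radLE n X).carrier (op ⦋i⦌) := by
  have := map_mem_moore (radLE n X).proj hx
  rw [mooreBounded_quotient_radLE n X i hi, Subgroup.mem_bot] at this
  exact (proj_eq_one_iff _).1 this

/-- Simplices of the coskeleton are detected by operators from degrees at most `n`; none of these is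
surjective onto `⦋n + 1⦌`, so all kill the cycle. -/
lemma mem_radGE_of_mem_cycles {n : ℕ} {x : X _⦋n + 1⦌} (hx : x ∈ X.cycles (n + 1)) :
    x ∈ (radGE (n + 1) X).carrier (op ⦋n + 1⦌) := by
  refine mem_ker.2 (cosk_ext fun j hj f => ?_)
  refine (ConcreteCategory.congr_hom
    (((SimplicialObject.coskAdj (C := GrpCat.{u}) n).unit.app X).naturality f.op) x).symm.trans ?_
  exact (congrArg (((SimplicialObject.coskAdj (C := GrpCat.{u}) n).unit.app X).app (op ⦋j⦌)).hom
    (map_eq_one_of_mem_cycles f (not_surjective_of_lt f (by omega)) hx)).trans (map_one _)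

/-! ### Vanishing homotopy of the radicals and their quotients -/

lemma subsingleton_homotopyGroup_of_moore_eq_bot {i : ℕ} (h : X.moore i = ⊥) :
    Subsingleton (homotopyGroup i X) :=
  subsingleton_homotopyGroup_iff.2 ((X.cycles_le_moore i).trans (h.le.trans bot_le))

lemma subsingleton_piUpLE (X : SimplicialGroup.{u}) {n i : ℕ} (hi : i < n + 1) :
    Subsingleton (homotopyGroup i (PiUpLE n X)) := by
  refine subsingleton_homotopyGroup_iff.2 fun z _ => ?_
  have h := mem_boundariesAt_of_mem_radLE (Nat.le_of_lt_succ hi) z.2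
  rw [boundariesAt] at h
  split_ifs at h with hin
  · obtain ⟨y, hy, hyz⟩ := mem_boundaries.1 h
    -- The bounding element has degree `n + 1`, where the radical contains the whole Moore complex.
    refine mem_boundaries.2 ⟨⟨y, mem_radLE_of_mem_moore (by omega) hy⟩, ?_, Subtype.ext hyz⟩
    exact mem_moore_of_map (radLE n X).isShortExact_proj.injective hy
  · rw [show z = 1 from Subtype.ext h]
    exact one_mem _

lemma subsingleton_piUpGE (X : SimplicialGroup.{u}) {n i : ℕ} (hi : i < n + 1) :
    Subsingleton (homotopyGroup i (PiUpGE (n + 1) X)) := by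
  refine subsingleton_homotopyGroup_iff.2 fun z _ => ?_
  rw [show z = 1 from Subtype.ext (eq_one_of_mem_radGE (Nat.le_of_lt_succ hi) z.2)]
  exact one_mem _

lemma subsingleton_piDownLE (X : SimplicialGroup.{u}) {n i : ℕ} (hi : n + 1 ≤ i) :
    Subsingleton (homotopyGroup i (PiDownLE n X)) :=
  subsingleton_homotopyGroup_of_moore_eq_bot (mooreBounded_quotient_radLE n X i hi)

lemma subsingleton_piDownGE (X : SimplicialGroup.{u}) {n i : ℕ} (hi : n + 1 ≤ i) :
    Subsingleton (homotopyGroup i (PiDownGE (n + 1) X)) := by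
  obtain hi | rfl := hi.lt_or_eq
  · exact subsingleton_homotopyGroup_of_moore_eq_bot
      (mooreBounded_quotient_ker _ (mooreBounded_cosk n X) i hi)
  -- In degree `n + 1` the coskeleton bound says nothing. The last face of the lift `x` lies in the
  -- radical in degree `n`, hence is trivial; so `x` is a cycle and vanishes in the quotient.
  · refine subsingleton_homotopyGroup_iff.2 fun z hz => ?_
    obtain ⟨x, hx, rfl⟩ := (radGE (n + 1) X).isShortExact_proj.exists_mem_moore
      (cycles_le_moore _ _ hz)
    have h := (mem_cycles_succ_iff.1 hz).2
    rw [map_δ] at h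
    have hx' := mem_cycles_succ_iff.2 ⟨hx, eq_one_of_mem_radGE le_rfl ((proj_eq_one_iff _).1 h)⟩
    rw [(proj_eq_one_iff _).2 (mem_radGE_of_mem_cycles hx')]
    exact one_mem _

end Radicals

/-! ### Homotopy of the fundamental simplicial groups -/

section FundamentalSimplicialGroups

variable (X : SimplicialGroup.{u})

lemma bijective_radLE_incl {n i : ℕ} (hi : n + 1 ≤ i) :
    Function.Bijective (homotopyGroupMap i (radLE n X).incl) :=
  (radLE n X).isShortExact_proj.map_bijective (subsingleton_piDownLE X hi)
    (subsingleton_piDownLE X (by omega))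

lemma bijective_radGE_incl {n i : ℕ} (hi : n + 1 ≤ i) :
    Function.Bijective (homotopyGroupMap i (radGE (n + 1) X).incl) :=
  (radGE (n + 1) X).isShortExact_proj.map_bijective (subsingleton_piDownGE X hi)
    (subsingleton_piDownGE X (by omega))

lemma bijective_radLE_proj {n i : ℕ} (hi : i < n + 1) :
    Function.Bijective (homotopyGroupMap i (radLE n X).proj) :=
  (radLE n X).isShortExact_proj.map_bijective_right
    fun _ hk _ => subsingleton_piUpLE X (hk.trans_lt hi)

lemma bijective_radGE_proj {n i : ℕ} (hi : i < n + 1) :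
    Function.Bijective (homotopyGroupMap i (radGE (n + 1) X).proj) :=
  (radGE (n + 1) X).isShortExact_proj.map_bijective_right
    fun _ hk _ => subsingleton_piUpGE X (hk.trans_lt hi)

/-- Two out of three: both radicals have the homotopy of `X` in these degrees. -/
lemma bijective_radGE_inclusion {n m i : ℕ} (h : n ≤ m) (hi : m + 1 ≤ i) :
    Function.Bijective
      (homotopyGroupMap i (inclusion (radGE_le_radLE (Nat.lt_succ_of_le h) X))) := by
  have hLE := bijective_radLE_incl X (n := n) (i := i) (by omega)
  have hGE := bijective_radGE_incl X hi
  rw [show (radGE (m + 1) X).incl =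
    inclusion (radGE_le_radLE (Nat.lt_succ_of_le h) X) ≫ (radLE n X).incl from rfl,
    homotopyGroupMap_comp] at hGE
  exact (hLE.of_comp_iff' _).1 hGE

/-- Allowing `m = n` includes the acyclic quotient, for which the excluded range of degrees is
empty. -/
lemma subsingleton_piLEGE {n m i : ℕ} (h : n ≤ m) (hi : ¬ (n + 1 ≤ i ∧ i < m + 1)) :
    Subsingleton (homotopyGroup i (PiLEGE (Nat.lt_succ_of_le h) X)) := by
  refine (isShortExact_subproj (radGE_le_radLE (Nat.lt_succ_of_le h) X)).subsingleton_right
    ?_ ?_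
  · obtain hi' | hi' := lt_or_ge i (n + 1)
    · have := subsingleton_piUpLE X hi'
      exact fun z => ⟨1, Subsingleton.elim _ _⟩
    · exact (bijective_radGE_inclusion X h (by omega)).2
  · rintro k rfl
    obtain hk | hk := lt_or_ge k (m + 1)
    · have := subsingleton_piUpGE X hk
      exact Function.injective_of_subsingleton _
    · exact (bijective_radGE_inclusion X h hk).1

lemma subsingleton_piLEGE_succ (n i : ℕ) :
    Subsingleton (homotopyGroup i (PiLEGE n.lt_succ_self X)) :=
  subsingleton_piLEGE X le_rfl (by omega)

/-- No direct map joins the quotient to `X`, so the isomorphism is the zigzag through `μ_{n ≥}`; the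
condition on `e` pins it down, since the projection is bijective on `π_i`. -/
lemma exists_piLEGE_mulEquiv {n m i : ℕ} (h : n < m) (hi : n + 1 ≤ i ∧ i < m + 1) :
    ∃ e : homotopyGroup i (PiLEGE (h.trans m.lt_succ_self) X) ≃* homotopyGroup i X,
      ∀ z : homotopyGroup i (PiUpLE n X),
        e (homotopyGroupMap i (subproj (radGE_le_radLE (h.trans m.lt_succ_self) X)) z) =
          homotopyGroupMap i (radLE n X).incl z := by
  have hp : Function.Bijective
      (homotopyGroupMap i (subproj (radGE_le_radLE (h.trans m.lt_succ_self) X))) :=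
    (isShortExact_subproj _).map_bijective_right
      fun _ hk _ => subsingleton_piUpGE X (hk.trans_lt hi.2)
  refine ⟨(MulEquiv.ofBijective _ hp).symm.trans
    (MulEquiv.ofBijective _ (bijective_radLE_incl X hi.1)), fun z => ?_⟩
  exact congrArg (homotopyGroupMap i (radLE n X).incl)
    ((MulEquiv.ofBijective _ hp).symm_apply_apply z)

end FundamentalSimplicialGroups

end SimplicialGroup

theorem mainTheorem3 (X : SimplicialGroup.{u}) :
    -- the homotopy groups of `Π^{n ≥}(X)` and `Π^{≥ n+1}(X)`
    (∀ n i : ℕ,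
      (n + 1 ≤ i →
        Function.Bijective
          (SimplicialGroup.homotopyGroupMap i (SimplicialGroup.radLE n X).incl) ∧
        Function.Bijective
          (SimplicialGroup.homotopyGroupMap i (SimplicialGroup.radGE (n + 1) X).incl)) ∧
      (i < n + 1 →
        Subsingleton (SimplicialGroup.homotopyGroup i (SimplicialGroup.PiUpLE n X)) ∧
        Subsingleton (SimplicialGroup.homotopyGroup i (SimplicialGroup.PiUpGE (n + 1) X)))) ∧
    -- the homotopy groups of `Π_{n ≥}(X)` and `Π_{≥ n+1}(X)`
    (∀ n i : ℕ,
      (n + 1 ≤ i →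
        Subsingleton (SimplicialGroup.homotopyGroup i (SimplicialGroup.PiDownLE n X)) ∧
        Subsingleton (SimplicialGroup.homotopyGroup i (SimplicialGroup.PiDownGE (n + 1) X))) ∧
      (i < n + 1 →
        Function.Bijective
          (SimplicialGroup.homotopyGroupMap i (SimplicialGroup.radLE n X).proj) ∧
        Function.Bijective
          (SimplicialGroup.homotopyGroupMap i (SimplicialGroup.radGE (n + 1) X).proj))) ∧
    -- the homotopy groups of `Π^{n ≥}_{≥ n+1}(X)`
    (∀ n i : ℕ,
      Subsingleton
        (SimplicialGroup.homotopyGroup i (SimplicialGroup.PiLEGE n.lt_succ_self X))) ∧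
    -- the homotopy groups of `Π^{n ≥}_{≥ m+1}(X)`
    (∀ (n m : ℕ) (h : n < m) (i : ℕ),
      (n + 1 ≤ i ∧ i < m + 1 →
        ∃ e : SimplicialGroup.homotopyGroup i
            (SimplicialGroup.PiLEGE (h.trans m.lt_succ_self) X) ≃*
              SimplicialGroup.homotopyGroup i X,
          ∀ z : SimplicialGroup.homotopyGroup i (SimplicialGroup.PiUpLE n X),
            e (SimplicialGroup.homotopyGroupMap i
                (SimplicialGroup.NormalSubobject.subproj
                  (SimplicialGroup.radGE_le_radLE (h.trans m.lt_succ_self) X)) z) =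
              SimplicialGroup.homotopyGroupMap i (SimplicialGroup.radLE n X).incl z) ∧
      (¬ (n + 1 ≤ i ∧ i < m + 1) →
        Subsingleton (SimplicialGroup.homotopyGroup i
          (SimplicialGroup.PiLEGE (h.trans m.lt_succ_self) X)))) ∧
    -- the four variants have the same homotopy groups
    (∀ (n m : ℕ) (h : n < m) (i : ℕ),
      Function.Bijective
        (SimplicialGroup.homotopyGroupMap i (SimplicialGroup.piLEGEToLELE h X)) ∧
      Function.Bijective
        (SimplicialGroup.homotopyGroupMap i (SimplicialGroup.piGEGEToLEGE h X)) ∧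
      Function.Bijective
        (SimplicialGroup.homotopyGroupMap i (SimplicialGroup.piGEGEToGELE h X)) ∧
      Function.Bijective
        (SimplicialGroup.homotopyGroupMap i (SimplicialGroup.piGELEToLELE h X))) ∧
    -- the homotopy groups of `Π^{n ≥}_{≥ n+2}(X)`
    (∀ n i : ℕ,
      (i = n + 1 →
        ∃ e : SimplicialGroup.homotopyGroup i
            (SimplicialGroup.PiLEGE (n.lt_succ_self.trans (n + 1).lt_succ_self) X) ≃*
              SimplicialGroup.homotopyGroup i X,
          ∀ z : SimplicialGroup.homotopyGroup i (SimplicialGroup.PiUpLE n X),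
            e (SimplicialGroup.homotopyGroupMap i
                (SimplicialGroup.NormalSubobject.subproj (SimplicialGroup.radGE_le_radLE
                  (n.lt_succ_self.trans (n + 1).lt_succ_self) X)) z) =
              SimplicialGroup.homotopyGroupMap i (SimplicialGroup.radLE n X).incl z) ∧
      (i ≠ n + 1 →
        Subsingleton (SimplicialGroup.homotopyGroup i
          (SimplicialGroup.PiLEGE (n.lt_succ_self.trans (n + 1).lt_succ_self) X)))) := by
  open SimplicialGroup NormalSubobject in
  exact ⟨fun n i => ⟨fun hi => ⟨bijective_radLE_incl X hi, bijective_radGE_incl X hi⟩,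
      fun hi => ⟨subsingleton_piUpLE X hi, subsingleton_piUpGE X hi⟩⟩,
    fun n i => ⟨fun hi => ⟨subsingleton_piDownLE X hi, subsingleton_piDownGE X hi⟩,
      fun hi => ⟨bijective_radLE_proj X hi, bijective_radGE_proj X hi⟩⟩,
    subsingleton_piLEGE_succ X,
    fun n m h i => ⟨exists_piLEGE_mulEquiv X h, subsingleton_piLEGE X h.le⟩,
    fun n m h i => ⟨
      -- Of the four maps, the first and third are projections with acyclic kernel `μ_{m ≥} / μ_{≥
      -- m+1}`; the second and fourth are inclusions with acyclic cokernel `μ_{n ≥} / μ_{≥ n+1}`.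
      (isShortExact_subquotientMap (radLE_le_radLE h.le X)
        (radGE_le_radLE m.lt_succ_self X)).map_bijective_right
          fun k _ _ => subsingleton_piLEGE_succ X m k,
      (isShortExact_subquotientMap (radGE_le_radLE n.lt_succ_self X)
        (radGE_le_radGE (Nat.succ_le_succ h.le) X)).map_bijective
          (subsingleton_piLEGE_succ X n i) (subsingleton_piLEGE_succ X n (i + 1)),
      (isShortExact_subquotientMap (radLE_le_radGE (Nat.succ_le_of_lt h) X)
        (radGE_le_radLE m.lt_succ_self X)).map_bijective_right
          fun k _ _ => subsingleton_piLEGE_succ X m k,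
      (isShortExact_subquotientMap (radGE_le_radLE n.lt_succ_self X)
        (radLE_le_radGE (Nat.succ_le_of_lt h) X)).map_bijective
          (subsingleton_piLEGE_succ X n i) (subsingleton_piLEGE_succ X n (i + 1))⟩,
    fun n i => ⟨fun hi => exists_piLEGE_mulEquiv X n.lt_succ_self (by omega),
      fun hi => subsingleton_piLEGE X n.lt_succ_self.le (by omega)⟩⟩
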